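/- Let $\mathbb K$ be a field of characteristic $0$ and $R=\mathbb K[x,y,z]$, and let $M=\langle x,y,z\rangle$. Let $\mathcal A$ be an arrangement of $n$ distinct lines in $\mathbb P^2_{\mathbb K}$ with defining linear forms $\ell_1,\ldots,\ell_n\in R$ (so the $\ell_i$ are nonzero and pairwise non-proportional), and suppose that $\mathcal A$ has rank $3$, i.e. $\operatorname{ht}\langle \ell_1,\ldots,\ell_n\rangle=3$. Let $$I=\langle \ell_2\ell_3\cdots\ell_n,\ \ell_1\ell_3\cdots\ell_n,\ \ldots,\ \ell_1\ell_2\cdots\ell_{n-1}\rangle$$ be the ideal generated by all $(n-1)$-fold products of $\ell_1,\ldots,\ell_n$. Let $P_1,\ldots,P_s$ be the points of $\mathbb P^2_{\mathbb K}$ lying on at least two lines of $\mathcal A$, let $n_j$ be the number of lines of $\mathcal A$ through $P_j$, and let $I(P_j)\subset R$ be the ideal generated by all homogeneous polynomials vanishing at $P_j$. Then $I$ is the fat points ideal $$I=I(P_1)^{n_1-1}\cap\cdots\cap I(P_s)^{n_s-1},$$ and, with the symbolic powers of this fat points ideal being $$I^{(t)}=I(P_1)^{t(n_1-1)}\cap\cdots\cap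 I(P_s)^{t(n_s-1)}\qquad(t\ge 1),$$ for every integer $r\ge 1$ one has 1. $I^{(2r-1)}\subseteq M^{r-1}\cdot I^r$; 2. $I^{(2r)}\subseteq M^{r}\cdot I^r$. In particular (by 2.), the containment $I^{(rN)}\subseteq M^{r(N-1)}I^r$ of the Harbourne–Huneke conjecture holds with $N=2$ for the ideal $I$ of every rank-$3$ line arrangement. -/

import Mathlib

open MvPolynomial
open scoped LinearAlgebra.Projectivization

namespace LineArrangement

/-- The homogeneous coordinate ring `K[x, y, z]` of the projective plane over `K`. -/
abbrev CoordRing (K : Type*) [Field K] : Type _ := MvPolynomial (Fin 3) K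

/-- The projective plane over `K`. -/
abbrev Plane (K : Type*) [Field K] : Type _ := ℙ K (Fin 3 → K)

variable {K : Type*} [Field K]

/-- The irrelevant maximal ideal `⟨x, y, z⟩` of `K[x, y, z]`. -/
noncomputable def irrelevantIdeal (K : Type*) [Field K] : Ideal (CoordRing K) :=
  Ideal.span (Set.range (X : Fin 3 → CoordRing K))

/-- The ideal `I(P)` of a point `P`: the ideal generated by all homogeneous polynomials that
vanish at `P`. (For a homogeneous polynomial, vanishing does not depend on the chosen
representative of `P`.) -/
noncomputable def pointIdeal (P : Plane K) : Ideal (CoordRing K) :=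
  Ideal.span {f | (∃ d : ℕ, f.IsHomogeneous d) ∧ eval P.rep f = 0}

/-- The ideal `⋂ I(P) ^ m P`, over the points `P` of `S`, of the fat points scheme `∑ m P • P`
supported on a (finite) set of points `S`. -/
noncomputable def fatPointsIdeal (S : Set (Plane K)) (m : Plane K → ℕ) : Ideal (CoordRing K) :=
  ⨅ P ∈ S, pointIdeal P ^ m P

/-- The `t`-th symbolic power `⋂ I(P) ^ (t * m P)` of the fat points ideal `⋂ I(P) ^ m P`:
all multiplicities are multiplied by `t`. -/
noncomputable def fatPointsSymbolicPower (S : Set (Plane K)) (m : Plane K → ℕ) (t : ℕ) :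
    Ideal (CoordRing K) :=
  fatPointsIdeal S fun P => t * m P

variable {n : ℕ}

/-- The ideal generated by all `(n - 1)`-fold products of the forms `ℓ 1, …, ℓ n`. -/
noncomputable def productIdeal (ℓ : Fin n → CoordRing K) : Ideal (CoordRing K) :=
  Ideal.span (Set.range fun i => ∏ j ∈ Finset.univ.erase i, ℓ j)

/-- The number of lines `ℓ i = 0` passing through the point `P`. -/
noncomputable def numLines (ℓ : Fin n → CoordRing K) (P : Plane K) : ℕ :=
  Set.ncard {i : Fin n | eval P.rep (ℓ i) = 0}

/-- The singular locus: the points that lie on at least two of the lines. -/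
def singularLocus (ℓ : Fin n → CoordRing K) : Set (Plane K) :=
  {P | 2 ≤ numLines ℓ P}

/-- The multiplicity of the line arrangement's fat points scheme at `P`: one less than the number
of lines through `P`. -/
noncomputable def lineMult (ℓ : Fin n → CoordRing K) (P : Plane K) : ℕ :=
  numLines ℓ P - 1

/-- The `t`-th symbolic power of the fat points ideal of the line arrangement. -/
noncomputable def symbolicPower (ℓ : Fin n → CoordRing K) (t : ℕ) : Ideal (CoordRing K) :=
  fatPointsSymbolicPower (singularLocus ℓ) (lineMult ℓ) t

end LineArrangement

/-!
Let `F_L` be the ideal generated by a linear space `L` of linear forms, and `w(L)` the number of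
forms of a multiset `Λ` that lie in `L`. Each `a`-fold product of forms in `Λ` omits `|Λ| - a` of
them, so it lies in `F_L ^ (w(L) + a - |Λ|)`. Conversely, the ideal of `a`-fold products is the
intersection of these powers: working modulo the forms in `L`, by induction from large `L` to
small, any element of the intersection is a multiple of one further form of `Λ`, which can be
divided out.

Let `f` vanish to order `t (n_P - 1)` at every point `P` of an arrangement of `n` lines. On each
line the numbers `n_P - 1` add up to `n - 1`, so by Bézout `deg f < t (n - 1)` forces `f` to be
divisible by all the lines. As `n_P ≤ 2 (n_P - 1)`, dividing them out lowers `t` by at most two,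
hence `f` has order at least `⌈t/2⌉ (n - 1) + ⌊t/2⌋` at the origin. This is the order
required of an element of `F_⊤ ^ ⌊t/2⌋` times the ideal of `⌈t/2⌉ (n - 1)`-fold products of
`⌈t/2⌉` copies of the arrangement, and the latter ideal lies in `I ^ ⌈t/2⌉`.
-/

namespace LineArrangement

section MonomialIdeal

variable {ι R : Type*} [CommSemiring R]

theorem monomial_mem_span_X_pow (A : Finset ι) (m : ι →₀ ℕ) :
    monomial m (1 : R) ∈ Ideal.span (X '' (A : Set ι)) ^ ∑ i ∈ A, m i := by
  classical
  have hprod : ∏ i ∈ A, (X i : MvPolynomial ι R) ^ m i ∈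
      Ideal.span (X '' (A : Set ι)) ^ ∑ i ∈ A, m i := by
    rw [← Finset.prod_pow_eq_pow_sum]
    exact Ideal.prod_mem_prod fun i hi =>
      Ideal.pow_mem_pow (Ideal.subset_span (Set.mem_image_of_mem _ hi)) _
  refine Ideal.mem_of_dvd _ ?_ hprod
  rw [monomial_eq, C_1, one_mul,
    m.prod_of_support_subset (s := A ∪ m.support) Finset.subset_union_right _ (by simp)]
  exact Finset.prod_dvd_prod_of_subset _ _ _ Finset.subset_union_left

theorem span_X_pow_eq_span_monomial (A : Finset ι) (k : ℕ) :
    Ideal.span ((X : ι → MvPolynomial ι R) '' A) ^ k =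
      Ideal.span ((monomial · 1) '' {m : ι →₀ ℕ | k ≤ ∑ i ∈ A, m i}) := by
  classical
  refine le_antisymm ?_ (Ideal.span_le.2 ?_)
  · induction k with
    | zero =>
      rw [pow_zero, Ideal.one_eq_top, top_le_iff, Ideal.eq_top_iff_one]
      exact Ideal.subset_span ⟨0, by simp⟩
    | succ k ih =>
      rw [pow_succ]
      refine (Ideal.mul_mono_left ih).trans ?_
      rw [Ideal.span_mul_span', Ideal.span_le]
      rintro _ ⟨_, ⟨m, hm, rfl⟩, _, ⟨i, hi, rfl⟩, rfl⟩
      refine Ideal.subset_span ⟨m + Finsupp.single i 1, ?_, by simp [X, monomial_mul]⟩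
      have hi : i ∈ A := hi
      simpa [Finset.sum_add_distrib, Finsupp.single_apply, hi] using hm
  · rintro _ ⟨m, hm, rfl⟩
    exact Ideal.pow_le_pow_right hm (monomial_mem_span_X_pow A m)

theorem mem_span_X_pow_sup_iff {A A₀ : Finset ι} {k : ℕ} {f : MvPolynomial ι R} :
    f ∈ Ideal.span (X '' (A : Set ι)) ^ k ⊔ Ideal.span (X '' (A₀ : Set ι)) ↔
      ∀ m ∈ f.support, k ≤ ∑ i ∈ A, m i ∨ ∃ i ∈ A₀, m i ≠ 0 := by
  have hX : (X : ι → MvPolynomial ι R) '' (A₀ : Set ι) =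
      (monomial · 1) '' ((Finsupp.single · 1) '' (A₀ : Set ι)) := by
    rw [Set.image_image]; rfl
  rw [span_X_pow_eq_span_monomial, hX, ← Ideal.span_union, ← Set.image_union,
    mem_ideal_span_monomial_image]
  refine forall₂_congr fun m _ => ⟨?_, ?_⟩
  · rintro ⟨e, he | ⟨i, hi, rfl⟩, hle⟩
    · exact Or.inl (le_trans he (Finset.sum_le_sum fun i _ => hle i))
    · exact Or.inr ⟨i, hi, Nat.one_le_iff_ne_zero.1 (Finsupp.single_le_iff.1 hle)⟩
  · rintro (h | ⟨i, hi, hmi⟩)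
    · exact ⟨m, Or.inl h, le_rfl⟩
    · exact ⟨_, Or.inr ⟨i, hi, rfl⟩, Finsupp.single_le_iff.2 (Nat.one_le_iff_ne_zero.2 hmi)⟩

theorem mem_span_X_pow_sup_of_X_mul_mem [DecidableEq ι] {A A₀ : Finset ι} {k : ℕ}
    {f : MvPolynomial ι R} {j : ι} (hj : j ∉ A₀)
    (hf : X j * f ∈ Ideal.span (X '' (A : Set ι)) ^ k ⊔ Ideal.span (X '' (A₀ : Set ι))) :
    f ∈ Ideal.span (X '' (A : Set ι)) ^ (k - if j ∈ A then 1 else 0) ⊔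
      Ideal.span (X '' (A₀ : Set ι)) := by
  rw [mem_span_X_pow_sup_iff] at hf ⊢
  intro m hm
  have hm' : Finsupp.single j 1 + m ∈ (X j * f).support := by
    rw [support_X_mul]
    exact Finset.mem_map_of_mem _ hm
  refine (hf _ hm').imp (fun h => ?_) fun ⟨i, hi, hmi⟩ => ⟨i, hi, ?_⟩
  · simp only [Finsupp.add_apply, Finset.sum_add_distrib, Finsupp.single_apply,
      Finset.sum_ite_eq] at h
    omega
  · have hji : j ≠ i := fun h => hj (h ▸ hi)
    simpa [hji] using hmi

end MonomialIdeal

section LinearForms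

variable {R σ : Type*} [CommSemiring R] [Fintype σ]

/-- The linear form `∑ i, v i * X i`; linear forms are handled through their coefficient
vectors. -/
noncomputable def linForm : (σ → R) →ₗ[R] MvPolynomial σ R :=
  Fintype.linearCombination R X

/-- The ideal generated by a linear space `L` of linear forms, i.e. the ideal of the linear
subspace (flat) on which the forms in `L` vanish; larger `L` means smaller flats. -/
noncomputable def flatIdeal (L : Submodule R (σ → R)) : Ideal (MvPolynomial σ R) :=
  Ideal.span (linForm '' (L : Set (σ → R)))

theorem linForm_single_one [DecidableEq σ] (i : σ) :
    linForm (Pi.single i (1 : R)) = (X i : MvPolynomial σ R) := by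
  simp [linForm, Fintype.linearCombination_apply_single]

theorem linForm_isHomogeneous (v : σ → R) : (linForm v).IsHomogeneous 1 := by
  rw [linForm, Fintype.linearCombination_apply]
  refine IsHomogeneous.sum _ _ _ fun i _ => ?_
  rw [smul_eq_C_mul]
  exact isHomogeneous_C_mul_X _ _

theorem totalDegree_prod_linForm {Λ : Finset (σ → R)} (hΛ : ∏ v ∈ Λ, linForm v ≠ 0) :
    (∏ v ∈ Λ, linForm v).totalDegree = Λ.card := by
  simpa using (IsHomogeneous.prod Λ linForm (fun _ => 1)
    fun v _ => linForm_isHomogeneous v).totalDegree hΛ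

theorem exists_linForm_eq {f : MvPolynomial σ R} (hf : f.IsHomogeneous 1) :
    ∃ v : σ → R, linForm v = f := by
  rw [← mem_homogeneousSubmodule, homogeneousSubmodule_one_eq_span_X,
    ← Fintype.range_linearCombination] at hf
  exact hf

theorem linForm_mem_flatIdeal {L : Submodule R (σ → R)} {v : σ → R} (hv : v ∈ L) :
    linForm v ∈ flatIdeal L :=
  Ideal.subset_span (Set.mem_image_of_mem _ hv)

theorem flatIdeal_mono {L L' : Submodule R (σ → R)} (h : L ≤ L') : flatIdeal L ≤ flatIdeal L' :=
  Ideal.span_mono (Set.image_mono h)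

theorem flatIdeal_span (s : Set (σ → R)) :
    flatIdeal (Submodule.span R s) = Ideal.span (linForm '' s) := by
  rw [flatIdeal, ← Submodule.map_coe, Submodule.map_span]
  exact Submodule.span_span_of_tower _ _ _

theorem flatIdeal_span_singleton (w : σ → R) :
    flatIdeal (Submodule.span R {w}) = Ideal.span {linForm w} := by
  rw [flatIdeal_span, Set.image_singleton]

theorem flatIdeal_sup (L L' : Submodule R (σ → R)) :
    flatIdeal (L ⊔ L') = flatIdeal L ⊔ flatIdeal L' := by
  rw [← Submodule.span_eq L, ← Submodule.span_eq L', ← Submodule.span_union]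
  simp only [flatIdeal_span, Set.image_union, Ideal.span_union]

theorem flatIdeal_bot : flatIdeal (⊥ : Submodule R (σ → R)) = ⊥ := by
  simp [flatIdeal]

theorem flatIdeal_top : flatIdeal (⊤ : Submodule R (σ → R)) = idealOfVars σ R := by
  classical
  rw [← (Pi.basisFun R σ).span_eq, flatIdeal_span, ← Set.range_comp, idealOfVars]
  congr 2
  ext1 i
  simp [linForm_single_one]

theorem exists_mem_add_linForm_mul {L : Submodule R (σ → R)} {w : σ → R}
    {I : Ideal (MvPolynomial σ R)} {f : MvPolynomial σ R} (hf : f ∈ I ⊔ flatIdeal (L ⊔ R ∙ w)) :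
    ∃ y ∈ I ⊔ flatIdeal L, ∃ h, f = y + linForm w * h := by
  rw [flatIdeal_sup, flatIdeal_span_singleton, ← sup_assoc] at hf
  obtain ⟨y, hy, z, hz, rfl⟩ := Submodule.mem_sup.1 hf
  obtain ⟨h, rfl⟩ := Ideal.mem_span_singleton.1 hz
  exact ⟨y, hy, h, rfl⟩

/-- The linear change of coordinates taking the variables to the linear forms of a basis. -/
noncomputable def coordEquiv {ι : Type*} (b : Module.Basis ι R (σ → R)) :
    MvPolynomial ι R ≃ₐ[R] MvPolynomial σ R :=
  (SymmetricAlgebra.equivMvPolynomial b).symm.trans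
    (SymmetricAlgebra.equivMvPolynomial (Pi.basisFun R σ))

theorem coordEquiv_X {ι : Type*} (b : Module.Basis ι R (σ → R)) (i : ι) :
    coordEquiv b (X i) = linForm (b i) := by
  classical
  have h : (SymmetricAlgebra.equivMvPolynomial (Pi.basisFun R σ)).toLinearMap ∘ₗ
      SymmetricAlgebra.ι R (σ → R) = linForm := by
    refine (Pi.basisFun R σ).ext fun i => ?_
    rw [LinearMap.comp_apply, AlgEquiv.toLinearMap_apply,
      SymmetricAlgebra.equivMvPolynomial_ι_apply, Pi.basisFun_apply, linForm_single_one]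
  simpa [coordEquiv] using LinearMap.congr_fun h (b i)

theorem map_coordEquiv_span_X {ι : Type*} (b : Module.Basis ι R (σ → R)) (A : Set ι) :
    (Ideal.span (X '' A)).map (coordEquiv b).toRingEquiv =
      flatIdeal (Submodule.span R (b '' A)) := by
  rw [Ideal.map_span, flatIdeal_span, Set.image_image, Set.image_image]
  exact congrArg Ideal.span (Set.image_congr fun i _ => coordEquiv_X b i)

end LinearForms

section Division

theorem exists_basis_span_image_eq {K V : Type*} [DivisionRing K] [AddCommGroup V] [Module K V]
    {L₀ L : Submodule K V} (hle : L₀ ≤ L) {w : V} (hw : w ∉ L₀) :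
    ∃ (s : Set V) (b : Module.Basis s K V) (A₀ A : Set s) (j : s), b j = w ∧
      Submodule.span K (b '' A₀) = L₀ ∧ Submodule.span K (b '' A) = L := by
  have exists_extension : ∀ {s : Set V} {W : Submodule K V}, LinearIndepOn K id s → s ⊆ W →
      ∃ t, s ⊆ t ∧ LinearIndepOn K id t ∧ Submodule.span K t = W := fun hs hsW =>
    ⟨hs.extend hsW, hs.subset_extend hsW, hs.linearIndepOn_extend hsW, by
      rw [hs.span_extend_eq_span, Submodule.span_eq]⟩
  obtain ⟨s₀, -, hs₀, rfl⟩ := exists_extension (linearIndepOn_empty K id)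
    (Set.empty_subset (L₀ : Set V))
  obtain ⟨s₁, s, hs, hws, hs₀s, hs₁s, rfl⟩ : ∃ s₁ s : Set V, LinearIndepOn K id s ∧ w ∈ s ∧
      s₀ ⊆ s ∧ s₁ ⊆ s ∧ Submodule.span K s₁ = L := by
    by_cases hwL : w ∈ L
    · obtain ⟨s₁, hsub, hs₁, hspan⟩ := exists_extension (hs₀.id_insert hw)
        (Set.insert_subset hwL (Submodule.span_le.1 hle))
      exact ⟨s₁, s₁, hs₁, hsub (Set.mem_insert _ _), (Set.subset_insert _ _).trans hsub,
        subset_rfl, hspan⟩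
    · obtain ⟨s₁, hsub, hs₁, rfl⟩ := exists_extension hs₀ (Submodule.span_le.1 hle)
      exact ⟨s₁, insert w s₁, hs₁.id_insert hwL, Set.mem_insert _ _,
        hsub.trans (Set.subset_insert _ _), Set.subset_insert _ _, rfl⟩
  have hsub := hs.subset_extend (Set.subset_univ s)
  refine ⟨_, .extend hs, (↑) ⁻¹' s₀, (↑) ⁻¹' s₁, ⟨w, hsub hws⟩,
    Module.Basis.extend_apply_self hs _, ?_, ?_⟩ <;>
  rw [Module.Basis.coe_extend, Subtype.image_preimage_coe, Set.inter_eq_right.2]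
  exacts [hs₀s.trans hsub, hs₁s.trans hsub]

variable {K σ : Type*} [Field K] [Fintype σ]

theorem mem_of_linForm_mul_mem {L₀ L : Submodule K (σ → K)} (hle : L₀ ≤ L) {w : σ → K}
    [Decidable (w ∈ L)] (hw : w ∉ L₀) {k : ℕ} {f : MvPolynomial σ K}
    (hf : linForm w * f ∈ flatIdeal L ^ k ⊔ flatIdeal L₀) :
    f ∈ flatIdeal L ^ (k - if w ∈ L then 1 else 0) ⊔ flatIdeal L₀ := by
  classical
  obtain ⟨s, b, A₀, A, j, rfl, rfl, rfl⟩ := exists_basis_span_image_eq hle hw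
  have : Fintype s := FiniteDimensional.fintypeBasisIndex b
  have hmap : ∀ k, flatIdeal (Submodule.span K (b '' A)) ^ k ⊔
      flatIdeal (Submodule.span K (b '' A₀)) =
      (Ideal.span (X '' (A.toFinset : Set s)) ^ k ⊔
        Ideal.span (X '' (A₀.toFinset : Set s))).map (coordEquiv b).toRingEquiv := fun k => by
    simp only [Ideal.map_sup, Ideal.map_pow, map_coordEquiv_span_X, Set.coe_toFinset]
  have hmem : ∀ B : Set s, b j ∈ Submodule.span K (b '' B) ↔ j ∈ B.toFinset := fun B => by
    simp [b.mem_span_image]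
  obtain ⟨g, rfl⟩ := (coordEquiv b).toRingEquiv.surjective f
  rw [hmap] at hf ⊢
  have hX : linForm (b j) * (coordEquiv b).toRingEquiv g =
      (coordEquiv b).toRingEquiv (X j * g) := by
    rw [map_mul]
    exact congrArg (· * _) (coordEquiv_X b j).symm
  rw [hX, Ideal.apply_mem_of_equiv_iff] at hf
  rw [Ideal.apply_mem_of_equiv_iff, if_congr (hmem A) rfl rfl]
  exact mem_span_X_pow_sup_of_X_mul_mem (mt (hmem A₀).2 hw) hf

end Division

section Weight

variable {R V : Type*} [Semiring R] [AddCommMonoid V] [Module R V]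

open Classical in
/-- The number of members of `Λ`, counted with multiplicity, that lie in `L`: for linear forms,
the number of hyperplanes containing the flat of `L`. -/
noncomputable def weight (Λ : Multiset V) (L : Submodule R V) : ℕ :=
  Λ.countP (· ∈ L)

theorem weight_le_card (Λ : Multiset V) (L : Submodule R V) : weight Λ L ≤ Λ.card := by
  classical exact Multiset.countP_le_card _ _

theorem weight_eq_card {Λ : Multiset V} {L : Submodule R V} (h : ∀ v ∈ Λ, v ∈ L) :
    weight Λ L = Λ.card := by
  classical exact Multiset.countP_eq_card.2 h

theorem weight_cons (w : V) (Λ : Multiset V) (L : Submodule R V) [Decidable (w ∈ L)] :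
    weight (w ::ₘ Λ) L = weight Λ L + if w ∈ L then 1 else 0 := by
  rw [weight, Multiset.countP_cons, weight]
  congr

theorem weight_add (Λ Λ' : Multiset V) (L : Submodule R V) :
    weight (Λ + Λ') L = weight Λ L + weight Λ' L := by
  classical exact Multiset.countP_add _ _ _

theorem weight_nsmul (c : ℕ) (Λ : Multiset V) (L : Submodule R V) :
    weight (c • Λ) L = c * weight Λ L := by
  classical exact Multiset.countP_nsmul _ _ _

end Weight

section FoldProducts

variable {R σ : Type*} [CommSemiring R] [Fintype σ]

theorem prod_linForm_mem_pow_weight (Λ : Multiset (σ → R)) (L : Submodule R (σ → R)) :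
    (Λ.map linForm).prod ∈ flatIdeal L ^ weight Λ L := by
  classical
  induction Λ using Multiset.induction_on with
  | empty => simp [weight]
  | cons w Λ ih =>
    rw [Multiset.map_cons, Multiset.prod_cons, weight_cons]
    split_ifs with hw
    · exact mul_comm (linForm w) _ ▸ Ideal.mul_mem_mul ih (linForm_mem_flatIdeal hw)
    · exact Ideal.mul_mem_left _ _ ih

/-- The ideal generated by the `a`-fold products of the linear forms in `Λ`. -/
noncomputable def foldIdeal (Λ : Multiset (σ → R)) (a : ℕ) : Ideal (MvPolynomial σ R) :=
  Ideal.span ((fun t => (t.map linForm).prod) '' {t | t ≤ Λ ∧ t.card = a})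

theorem foldIdeal_zero (Λ : Multiset (σ → R)) : foldIdeal Λ 0 = ⊤ :=
  (Ideal.eq_top_iff_one _).2 (Ideal.subset_span ⟨0, by simp⟩)

theorem foldIdeal_le_flatIdeal_pow (Λ : Multiset (σ → R)) (a : ℕ) (L : Submodule R (σ → R)) :
    foldIdeal Λ a ≤ flatIdeal L ^ (weight Λ L + a - Λ.card) := by
  refine Ideal.span_le.2 ?_
  rintro _ ⟨t, ⟨ht, rfl⟩, rfl⟩
  obtain ⟨u, rfl⟩ := Multiset.le_iff_exists_add.1 ht
  refine Ideal.pow_le_pow_right ?_ (prod_linForm_mem_pow_weight t L)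
  rw [weight_add, Multiset.card_add]
  have := weight_le_card u L
  omega

theorem span_linForm_mul_foldIdeal_le (w : σ → R) (Λ : Multiset (σ → R)) (a : ℕ) :
    Ideal.span {linForm w} * foldIdeal Λ a ≤ foldIdeal (w ::ₘ Λ) (a + 1) := by
  rw [foldIdeal, Ideal.span_mul_span', Ideal.span_le]
  rintro _ ⟨_, rfl, _, ⟨t, ⟨ht, rfl⟩, rfl⟩, rfl⟩
  exact Ideal.subset_span ⟨w ::ₘ t, ⟨Multiset.cons_le_cons w ht, by simp⟩, by simp⟩

theorem linForm_mul_mem_mul_foldIdeal_sup {w : σ → R} {Λ : Multiset (σ → R)} {a : ℕ}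
    {I J : Ideal (MvPolynomial σ R)} {f : MvPolynomial σ R} (hf : f ∈ I * foldIdeal Λ a ⊔ J) :
    linForm w * f ∈ I * foldIdeal (w ::ₘ Λ) (a + 1) ⊔ J := by
  have hmul := Ideal.mul_mem_mul (Ideal.mem_span_singleton_self (linForm w)) hf
  rw [Ideal.mul_sup, mul_left_comm] at hmul
  exact sup_le_sup (Ideal.mul_mono_right (span_linForm_mul_foldIdeal_le w Λ a))
    Ideal.mul_le_right hmul

theorem pow_mul_foldIdeal_le_flatIdeal_top_pow (s a : ℕ) (Λ : Multiset (σ → R)) :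
    flatIdeal ⊤ ^ s * foldIdeal Λ a ≤ flatIdeal ⊤ ^ (a + s) := by
  have hle := foldIdeal_le_flatIdeal_pow Λ a ⊤
  rw [weight_eq_card fun _ _ => Submodule.mem_top, Nat.add_sub_cancel_left] at hle
  rw [pow_add, mul_comm]
  exact Ideal.mul_mono_left hle

theorem card_nsmul_eq_add_bind_erase {α : Type*} [DecidableEq α] {u Λ : Multiset α} (h : u ⊆ Λ) :
    u.card • Λ = u + u.bind Λ.erase := by
  induction u using Multiset.induction_on with
  | empty => simp
  | cons w u ih =>
    obtain ⟨hw, hu⟩ := Multiset.cons_subset.1 h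
    rw [Multiset.card_cons, succ_nsmul', ih hu, Multiset.cons_bind]
    nth_rw 1 [← Multiset.cons_erase hw]
    rw [← Multiset.singleton_add, ← Multiset.singleton_add]
    abel

/-- Removing `r` forms from `r` copies of `Λ` amounts to removing one form from each copy. -/
theorem foldIdeal_nsmul_le_pow {Λ : Multiset (σ → R)} (hΛ : Λ ≠ 0) (r : ℕ) :
    foldIdeal (r • Λ) (r * (Λ.card - 1)) ≤ foldIdeal Λ (Λ.card - 1) ^ r := by
  classical
  have prod_mem_pow_card : ∀ u : Multiset (σ → R), u ⊆ Λ →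
      ((u.bind Λ.erase).map linForm).prod ∈ foldIdeal Λ (Λ.card - 1) ^ u.card := fun u hu => by
    induction u using Multiset.induction_on with
    | empty => simp
    | cons w u ih =>
      obtain ⟨hw, hu⟩ := Multiset.cons_subset.1 hu
      rw [Multiset.cons_bind, Multiset.map_add, Multiset.prod_add, Multiset.card_cons, pow_succ']
      exact Ideal.mul_mem_mul (Ideal.subset_span
        ⟨Λ.erase w, ⟨Multiset.erase_le _ _, Multiset.card_erase_of_mem hw⟩, rfl⟩) (ih hu)
  refine Ideal.span_le.2 ?_
  rintro _ ⟨t, ⟨ht, htcard⟩, rfl⟩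
  obtain ⟨u, hu⟩ := Multiset.le_iff_exists_add.1 ht
  have hur : u.card = r := by
    have hcard := congrArg Multiset.card hu
    rw [Multiset.card_nsmul, Multiset.card_add, htcard] at hcard
    have hpos := Nat.mul_sub_one r Λ.card
    have hle := Nat.le_mul_of_pos_right r (Multiset.card_pos.2 hΛ)
    omega
  have huΛ : u ⊆ Λ := fun w hw =>
    Multiset.mem_of_mem_nsmul (n := r) (hu ▸ Multiset.mem_add.2 (.inr hw))
  have hterase : t = u.bind Λ.erase := by
    rw [← hur, card_nsmul_eq_add_bind_erase huΛ, add_comm] at hu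
    exact (add_right_cancel hu).symm
  subst hterase hur
  exact prod_mem_pow_card u huΛ

end FoldProducts

section PrimaryDecomposition

variable {K σ : Type*} [Field K] [Fintype σ]

/-- With `s = 0` and `L₀ = ⊥` this says that the ideal of `a`-fold products is the intersection of
the powers of the flat ideals that contain it for the obvious reason. The induction on `L₀` and `a`
needs the version modulo the linear forms in `L₀`. -/
theorem mem_pow_mul_foldIdeal_sup (s : ℕ) (L₀ : Submodule K (σ → K)) :
    ∀ (a : ℕ) (Λ : Multiset (σ → K)) (f : MvPolynomial σ K),
      (∀ L, L₀ ≤ L → f ∈ flatIdeal L ^ (weight Λ L + a - Λ.card) ⊔ flatIdeal L₀) →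
      f ∈ flatIdeal ⊤ ^ (a + s) ⊔ flatIdeal L₀ →
      f ∈ flatIdeal ⊤ ^ s * foldIdeal Λ a ⊔ flatIdeal L₀ := by
  classical
  induction L₀ using WellFoundedGT.induction with
  | ind L₀ ihL =>
  intro a
  induction a with
  | zero => simp [foldIdeal_zero]
  | succ a iha =>
  intro Λ f hflat htop
  by_cases hall : ∀ w ∈ Λ, w ∈ L₀
  · have hf := hflat L₀ le_rfl
    rw [weight_eq_card hall, Nat.add_sub_cancel_left,
      sup_eq_right.2 (Ideal.pow_le_self a.succ_ne_zero)] at hf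
    exact Ideal.mem_sup_right hf
  push Not at hall
  obtain ⟨w, hwΛ, hw⟩ := hall
  obtain ⟨Λ, rfl⟩ := Multiset.exists_cons_of_mem hwΛ
  have hlt : L₀ < L₀ ⊔ K ∙ w := Submodule.lt_sup_iff_notMem.2 hw
  have hmono := sup_le_sup_left (flatIdeal_mono hlt.le)
  obtain ⟨y, hy, h, rfl⟩ := exists_mem_add_linForm_mul <| ihL _ hlt (a + 1) (w ::ₘ Λ) f
    (fun L hL => hmono _ (hflat L (hlt.le.trans hL))) (hmono _ htop)
  have linForm_mul_mem : ∀ I, flatIdeal ⊤ ^ s * foldIdeal (w ::ₘ Λ) (a + 1) ≤ I →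
      y + linForm w * h ∈ I ⊔ flatIdeal L₀ → linForm w * h ∈ I ⊔ flatIdeal L₀ := fun I hI =>
    (Ideal.add_mem_iff_right _ (sup_le_sup_right hI _ hy)).1
  have hh : h ∈ flatIdeal ⊤ ^ s * foldIdeal Λ a ⊔ flatIdeal L₀ := by
    refine iha Λ h (fun L hL => ?_) ?_
    · have := mem_of_linForm_mul_mem hL hw (linForm_mul_mem _
        (Ideal.mul_le_right.trans (foldIdeal_le_flatIdeal_pow _ _ L)) (hflat L hL))
      convert this using 3
      rw [weight_cons, Multiset.card_cons]
      omega
    · have := mem_of_linForm_mul_mem le_top hw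
        (linForm_mul_mem _ (pow_mul_foldIdeal_le_flatIdeal_top_pow s (a + 1) _) htop)
      convert this using 3
      simp only [Submodule.mem_top, if_true]
      omega
  exact Ideal.add_mem _ hy (linForm_mul_mem_mul_foldIdeal_sup hh)

end PrimaryDecomposition

section Degree

attribute [local instance] MvPolynomial.gradedAlgebra

variable {R σ : Type*} [CommRing R] [Fintype σ]

theorem flatIdeal_pow_isHomogeneous (L : Submodule R (σ → R)) (k : ℕ) :
    (flatIdeal L ^ k).IsHomogeneous (homogeneousSubmodule σ R) := by
  induction k with
  | zero =>
    rw [pow_zero, Ideal.one_eq_top]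
    exact Ideal.IsHomogeneous.top _
  | succ k ih =>
    refine pow_succ (flatIdeal L) k ▸ ih.mul (Ideal.homogeneous_span _ _ ?_)
    rintro _ ⟨v, -, rfl⟩
    exact ⟨1, linForm_isHomogeneous v⟩

theorem homogeneousComponent_mem_flatIdeal_pow {L : Submodule R (σ → R)} {k : ℕ}
    {f : MvPolynomial σ R} (hf : f ∈ flatIdeal L ^ k) (d : ℕ) :
    homogeneousComponent d f ∈ flatIdeal L ^ k :=
  homogeneousComponent_mem_of_mem (flatIdeal_pow_isHomogeneous L k) hf d

theorem mem_flatIdeal_top_pow_iff {f : MvPolynomial σ R} {d : ℕ} :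
    f ∈ flatIdeal ⊤ ^ d ↔ ∀ e < d, homogeneousComponent e f = 0 := by
  rw [flatIdeal_top, mem_pow_idealOfVars_iff']
  refine ⟨fun h e he => ?_, fun h m hm => ?_⟩
  · ext m
    rw [coeff_homogeneousComponent, coeff_zero]
    split_ifs with hm
    exacts [h m (hm ▸ he), rfl]
  · simpa [coeff_homogeneousComponent] using congrArg (coeff m) (h _ hm)

theorem mem_flatIdeal_of_totalDegree_lt {L : Submodule R (σ → R)} {d : ℕ} {f : MvPolynomial σ R}
    (hd : f.totalDegree < d) (hf : f ∈ flatIdeal ⊤ ^ d ⊔ flatIdeal L) : f ∈ flatIdeal L := by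
  obtain ⟨x, hx, y, hy, rfl⟩ := Submodule.mem_sup.1 hf
  rw [← pow_one (flatIdeal L)] at hy ⊢
  refine (mem_iff_homogeneousComponent_mem (flatIdeal_pow_isHomogeneous L 1) _).2 fun e => ?_
  by_cases he : e < d
  · rw [map_add, mem_flatIdeal_top_pow_iff.1 hx e he, zero_add]
    exact homogeneousComponent_mem_flatIdeal_pow hy e
  · rw [homogeneousComponent_eq_zero _ _ (hd.trans_le (not_lt.1 he))]
    exact Ideal.zero_mem _

end Degree

section Arrangement

theorem sup_span_singleton_eq_of_covBy {R V : Type*} [Semiring R] [AddCommMonoid V] [Module R V]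
    {L₀ L : Submodule R V} (h : L₀ ⋖ L) {w : V} (hwL : w ∈ L) (hw : w ∉ L₀) : L₀ ⊔ R ∙ w = L :=
  (h.eq_or_eq le_sup_left (sup_le h.le ((Submodule.span_singleton_le_iff_mem _ _).2 hwL)))
    |>.resolve_left (Submodule.lt_sup_iff_notMem.2 hw).ne'

variable {K σ : Type*} [Field K] [Fintype σ]

/-- The Bézout-type input: a curve meets a line in at most as many points, counted with
multiplicity, as its degree says. Here `L₀` is the line and the `L ∈ s` are points on it. -/
theorem mem_flatIdeal_top_pow_sum_sup {L₀ : Submodule K (σ → K)}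
    {s : Finset (Submodule K (σ → K))} (hs : ∀ L ∈ s, L₀ ⋖ L) (k : Submodule K (σ → K) → ℕ)
    {f : MvPolynomial σ K} (hf : ∀ L ∈ s, f ∈ flatIdeal L ^ k L ⊔ flatIdeal L₀) :
    f ∈ flatIdeal ⊤ ^ (∑ L ∈ s, k L) ⊔ flatIdeal L₀ := by
  classical
  induction hN : ∑ L ∈ s, k L generalizing k f with
  | zero => simp
  | succ N ih =>
    obtain ⟨L, hL, hkL⟩ : ∃ L ∈ s, k L ≠ 0 := Finset.exists_ne_zero_of_sum_ne_zero (by omega)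
    obtain ⟨w, hwL, hw⟩ := SetLike.exists_of_lt (hs L hL).lt
    have sup_eq_of_mem : ∀ L' ∈ s, w ∈ L' → L₀ ⊔ K ∙ w = L' := fun L' hL' hwL' =>
      sup_span_singleton_eq_of_covBy (hs L' hL') hwL' hw
    obtain ⟨y, hy, h, rfl⟩ : ∃ y ∈ ⊥ ⊔ flatIdeal L₀, ∃ h, f = y + linForm w * h := by
      refine exists_mem_add_linForm_mul ?_
      rw [bot_sup_eq, sup_eq_of_mem L hL hwL]
      exact sup_le (Ideal.pow_le_self hkL) (flatIdeal_mono (hs L hL).le) (hf L hL)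
    rw [bot_sup_eq] at hy
    have hsum : ∑ L' ∈ s, (k L' - if w ∈ L' then 1 else 0) = N := by
      have hother : ∑ L' ∈ s.erase L, (k L' - if w ∈ L' then 1 else 0) =
          ∑ L' ∈ s.erase L, k L' := by
        refine Finset.sum_congr rfl fun L' hL' => ?_
        obtain ⟨hne, hL'⟩ := Finset.mem_erase.1 hL'
        rw [if_neg fun hwL' => hne ((sup_eq_of_mem L' hL' hwL').symm.trans
          (sup_eq_of_mem L hL hwL)), Nat.sub_zero]
      rw [← Finset.add_sum_erase s _ hL] at hN ⊢
      rw [hother, if_pos hwL]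
      omega
    have hh : h ∈ flatIdeal ⊤ ^ N ⊔ flatIdeal L₀ :=
      ih _ (fun L' hL' => mem_of_linForm_mul_mem (hs L' hL').le hw
        ((Ideal.add_mem_iff_right _ (Ideal.mem_sup_right hy)).1 (hf L' hL'))) hsum
    refine Ideal.add_mem _ (Ideal.mem_sup_right hy) ?_
    have hmul := Ideal.mul_mem_mul
      (linForm_mem_flatIdeal (Submodule.mem_top : w ∈ (⊤ : Submodule K (σ → K)))) hh
    rw [Ideal.mul_sup, ← pow_succ'] at hmul
    exact sup_le_sup (le_refl (flatIdeal ⊤ ^ (N + 1))) Ideal.mul_le_right hmul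

theorem mem_of_prod_linForm_mul_mem {L₀ L : Submodule K (σ → K)} (hle : L₀ ≤ L)
    {Λ : Multiset (σ → K)} (hΛ : ∀ w ∈ Λ, w ∉ L₀) {k : ℕ} {f : MvPolynomial σ K}
    (hf : (Λ.map linForm).prod * f ∈ flatIdeal L ^ k ⊔ flatIdeal L₀) :
    f ∈ flatIdeal L ^ (k - weight Λ L) ⊔ flatIdeal L₀ := by
  classical
  induction Λ using Multiset.induction_on generalizing k with
  | empty => simpa [weight] using hf
  | cons w Λ ih =>
    rw [Multiset.map_cons, Multiset.prod_cons, mul_assoc] at hf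
    rw [weight_cons, add_comm, ← Nat.sub_sub]
    exact ih (fun v hv => hΛ v (Multiset.mem_cons_of_mem hv))
      (mem_of_linForm_mul_mem hle (hΛ w (Multiset.mem_cons_self w Λ)) hf)

theorem prod_linForm_dvd {Λ : Finset (σ → K)}
    (hΛ : (Λ : Set (σ → K)).Pairwise fun u v => u ∉ K ∙ v) {f : MvPolynomial σ K}
    (hf : ∀ v ∈ Λ, linForm v ∣ f) : ∏ v ∈ Λ, linForm v ∣ f := by
  classical
  induction Λ using Finset.induction_on with
  | empty => exact one_dvd f
  | insert a Λ ha ih =>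
    obtain ⟨g, rfl⟩ := ih (hΛ.mono (Finset.coe_subset.2 (Finset.subset_insert a Λ)))
      fun v hv => hf v (Finset.mem_insert_of_mem hv)
    have hmem : ∀ v ∈ Λ.val, v ∉ K ∙ a := fun v hv =>
      hΛ (Finset.mem_insert_of_mem hv) (Finset.mem_insert_self a Λ) fun h => ha (h ▸ hv)
    have hweight : weight Λ.val (K ∙ a) = 0 := Multiset.countP_eq_zero.2 hmem
    have hg : g ∈ flatIdeal (K ∙ a) ^ (1 - weight Λ.val (K ∙ a)) ⊔ flatIdeal (K ∙ a) := by
      refine mem_of_prod_linForm_mul_mem le_rfl hmem ?_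
      rw [pow_one, sup_idem, flatIdeal_span_singleton, Ideal.mem_span_singleton]
      exact hf a (Finset.mem_insert_self a Λ)
    rw [hweight, pow_one, sup_idem, flatIdeal_span_singleton, Ideal.mem_span_singleton] at hg
    rw [Finset.prod_insert ha, mul_comm]
    exact mul_dvd_mul_left _ hg

end Arrangement

section Pencil

variable {R V : Type*} [Semiring R] [AddCommMonoid V] [Module R V] {Λ : Finset V}

theorem ne_zero_of_pairwise_notMem_span (hΛ : (Λ : Set V).Pairwise fun u v => u ∉ R ∙ v)
    (hcard : 2 ≤ Λ.card) {v : V} (hv : v ∈ Λ) : v ≠ 0 := by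
  rintro rfl
  obtain ⟨u, hu, hne⟩ := Finset.exists_mem_ne hcard 0
  exact hΛ hv hu hne.symm (Submodule.zero_mem _)

theorem card_sub_one_le_sum_weight [DecidableEq V] [DecidableEq (Submodule R V)]
    {v : V} (hv : v ∈ Λ) :
    Λ.card - 1 ≤
      ∑ L ∈ (Λ.erase v).image fun u => (R ∙ v) ⊔ R ∙ u, (weight Λ.val L - 1) := by
  classical
  rw [← Finset.card_erase_of_mem hv,
    Finset.card_eq_sum_card_image (fun u => (R ∙ v) ⊔ R ∙ u) (Λ.erase v)]
  refine Finset.sum_le_sum fun L hL => ?_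
  obtain ⟨u, -, rfl⟩ := Finset.mem_image.1 hL
  have hvL : v ∈ Λ.filter (· ∈ (R ∙ v) ⊔ R ∙ u) := Finset.mem_filter.2
    ⟨hv, Submodule.mem_sup_left (Submodule.mem_span_singleton_self v)⟩
  have hweight : weight Λ.val ((R ∙ v) ⊔ R ∙ u) = (Λ.filter (· ∈ (R ∙ v) ⊔ R ∙ u)).card := by
    rw [weight, Multiset.countP_eq_card_filter]
    rfl
  rw [hweight, ← Finset.card_erase_of_mem hvL]
  refine Finset.card_le_card fun w hw => ?_
  obtain ⟨hwΛ, hwu⟩ := Finset.mem_filter.1 hw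
  obtain ⟨hne, hwΛ⟩ := Finset.mem_erase.1 hwΛ
  exact Finset.mem_erase.2 ⟨hne, Finset.mem_filter.2 ⟨hwΛ, hwu ▸
    Submodule.mem_sup_right (Submodule.mem_span_singleton_self w)⟩⟩

end Pencil

theorem finrank_span_sup_span {K V : Type*} [DivisionRing K] [AddCommGroup V] [Module K V]
    {v w : V} (hv : v ≠ 0) (hw : w ∉ K ∙ v) :
    Module.finrank K ↥((K ∙ v) ⊔ K ∙ w) = 2 := by
  have hli : LinearIndependent K ![v, w] :=
    (LinearIndependent.pair_iff' hv).2 fun a h => hw (Submodule.mem_span_singleton.2 ⟨a, h⟩)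
  have h := finrank_span_eq_card hli
  rwa [Matrix.range_cons, Matrix.range_cons, Matrix.range_empty, Set.union_empty,
    Set.singleton_union, Submodule.span_insert, Fintype.card_fin] at h

section Vanishing

variable {K σ : Type*} [Field K] [Fintype σ] {Λ : Finset (σ → K)}

theorem linForm_dvd_of_vanishing (hΛ : (Λ : Set (σ → K)).Pairwise fun u v => u ∉ K ∙ v)
    {v : σ → K} (hv : v ∈ Λ) (hv₀ : v ≠ 0) {t : ℕ} {f : MvPolynomial σ K}
    (hd : f.totalDegree < t * (Λ.card - 1))
    (hf : ∀ L : Submodule K (σ → K), Module.finrank K L = 2 →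
      f ∈ flatIdeal L ^ (t * (weight Λ.val L - 1))) : linForm v ∣ f := by
  classical
  set s := (Λ.erase v).image fun u => (K ∙ v) ⊔ K ∙ u
  have hs : ∀ L ∈ s, (K ∙ v) ⋖ L ∧ Module.finrank K L = 2 := by
    intro L hL
    obtain ⟨u, hu, rfl⟩ := Finset.mem_image.1 hL
    obtain ⟨hne, huΛ⟩ := Finset.mem_erase.1 hu
    have huv : u ∉ K ∙ v := hΛ huΛ hv hne
    exact ⟨sup_comm (K ∙ u) (K ∙ v) ▸ Submodule.covBy_span_singleton_sup huv,
      finrank_span_sup_span hv₀ huv⟩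
  have hmem : f ∈ flatIdeal ⊤ ^ (∑ L ∈ s, t * (weight Λ.val L - 1)) ⊔ flatIdeal (K ∙ v) :=
    mem_flatIdeal_top_pow_sum_sup (fun L hL => (hs L hL).1) _
      fun L hL => Ideal.mem_sup_left (hf L (hs L hL).2)
  rw [← Finset.mul_sum] at hmem
  rw [← Ideal.mem_span_singleton, ← flatIdeal_span_singleton]
  exact mem_flatIdeal_of_totalDegree_lt
    (hd.trans_le (Nat.mul_le_mul_left t (card_sub_one_le_sum_weight hv))) hmem

theorem mem_flatIdeal_pow_of_prod_linForm_mul_mem (hΛ : ∀ v ∈ Λ, v ≠ 0)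
    {L : Submodule K (σ → K)} {k : ℕ} {f : MvPolynomial σ K}
    (hf : (∏ v ∈ Λ, linForm v) * f ∈ flatIdeal L ^ k) :
    f ∈ flatIdeal L ^ (k - weight Λ.val L) := by
  simpa [flatIdeal_bot] using mem_of_prod_linForm_mul_mem bot_le (Λ := Λ.val)
    (fun v hv => by simpa using hΛ v hv) (Ideal.mem_sup_left hf)

theorem eq_zero_of_vanishing (hΛ : (Λ : Set (σ → K)).Pairwise fun u v => u ∉ K ∙ v)
    (hcard : 2 ≤ Λ.card) (t : ℕ) {f : MvPolynomial σ K}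
    (hd : f.totalDegree < (t + 1) / 2 * (Λ.card - 1) + t / 2)
    (hf : ∀ L : Submodule K (σ → K), Module.finrank K L = 2 →
      f ∈ flatIdeal L ^ (t * (weight Λ.val L - 1))) : f = 0 := by
  by_contra hf₀
  have hne : ∀ v ∈ Λ, v ≠ 0 := fun v hv => ne_zero_of_pairwise_notMem_span hΛ hcard hv
  have hd' : f.totalDegree < t * (Λ.card - 1) := by
    have hhalf : t / 2 ≤ t / 2 * (Λ.card - 1) := Nat.le_mul_of_pos_right _ (by omega)
    have ht : t * (Λ.card - 1) = (t + 1) / 2 * (Λ.card - 1) + t / 2 * (Λ.card - 1) := by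
      rw [← add_mul]
      congr 1
      omega
    omega
  obtain ⟨g, rfl⟩ := prod_linForm_dvd hΛ fun v hv =>
    linForm_dvd_of_vanishing hΛ hv (hne v hv) hd' hf
  have hprod := left_ne_zero_of_mul hf₀
  rw [totalDegree_mul_of_isDomain hprod (right_ne_zero_of_mul hf₀),
    totalDegree_prod_linForm hprod] at hd
  match t with
  | 0 => simp at hd
  | 1 => simp at hd; omega
  | t + 2 =>
    refine right_ne_zero_of_mul hf₀ (eq_zero_of_vanishing hΛ hcard t ?_ fun L hL => ?_)
    · rw [show (t + 2 + 1) / 2 = (t + 1) / 2 + 1 by omega, add_one_mul] at hd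
      omega
    · refine Ideal.pow_le_pow_right ?_ (mem_flatIdeal_pow_of_prod_linForm_mul_mem hne (hf L hL))
      obtain hw | hw := le_or_gt (weight Λ.val L) 1
      · simp only [Nat.sub_eq_zero_of_le hw, mul_zero, zero_le]
      · rw [add_mul]
        omega

theorem mem_flatIdeal_top_pow_of_vanishing
    (hΛ : (Λ : Set (σ → K)).Pairwise fun u v => u ∉ K ∙ v) (hcard : 2 ≤ Λ.card) {t : ℕ}
    {f : MvPolynomial σ K}
    (hf : ∀ L : Submodule K (σ → K), Module.finrank K L = 2 →
      f ∈ flatIdeal L ^ (t * (weight Λ.val L - 1))) :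
    f ∈ flatIdeal ⊤ ^ ((t + 1) / 2 * (Λ.card - 1) + t / 2) :=
  mem_flatIdeal_top_pow_iff.2 fun e he => eq_zero_of_vanishing hΛ hcard t
    ((homogeneousComponent_isHomogeneous e f).totalDegree_le.trans_lt he)
    fun L hL => homogeneousComponent_mem_flatIdeal_pow (hf L hL) e

end Vanishing

section Points

theorem aeval_mul_of_isHomogeneous {R σ A : Type*} [CommSemiring R] [CommSemiring A] [Algebra R A]
    {f : MvPolynomial σ R} {d : ℕ} (hf : f.IsHomogeneous d) (a : σ → A) (y : A) :
    aeval (fun i => a i * y) f = aeval a f * y ^ d := by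
  rw [aeval_def, aeval_def, eval₂_eq, eval₂_eq, Finset.sum_mul]
  refine Finset.sum_congr rfl fun m hm => ?_
  simp only [mul_pow, Finset.prod_mul_distrib, Finset.prod_pow_eq_pow_sum]
  rw [← hf.degree_eq_sum_deg_support hm, mul_assoc]

variable {K σ : Type*} [Field K] [Fintype σ]

/-- The space of coefficient vectors of the linear forms vanishing at `p`. -/
noncomputable def formsVanishingAt (p : σ → K) : Submodule K (σ → K) :=
  LinearMap.ker (Fintype.linearCombination K p)

theorem mem_formsVanishingAt {p v : σ → K} : v ∈ formsVanishingAt p ↔ eval p (linForm v) = 0 := by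
  simp [formsVanishingAt, linForm, Fintype.linearCombination_apply, smul_eval]

/-- Modulo the forms vanishing at `p` one has `p j * X i = p i * X j`, so that `f` becomes a
multiple of its value at `p`. -/
theorem mem_flatIdeal_of_eval_eq_zero {p : σ → K} (hp : p ≠ 0) {f : MvPolynomial σ K} {d : ℕ}
    (hd : f.IsHomogeneous d) (hf : eval p f = 0) : f ∈ flatIdeal (formsVanishingAt p) := by
  classical
  obtain ⟨j, hj⟩ := Function.ne_iff.1 hp
  set π := Ideal.Quotient.mkₐ K (flatIdeal (formsVanishingAt p))
  have hX : ∀ i, π (X i) * π (C (p j)) = π (C (p i)) * π (X j) := fun i => by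
    have hmem : Pi.single i (p j) - Pi.single j (p i) ∈ formsVanishingAt p := by
      simp [formsVanishingAt, Fintype.linearCombination_apply_single, mul_comm]
    rw [← map_mul, ← map_mul, Ideal.Quotient.mkₐ_eq_mk, Ideal.Quotient.eq]
    simpa [linForm, Fintype.linearCombination_apply_single, smul_eq_C_mul, mul_comm]
      using linForm_mem_flatIdeal hmem
  have hval : aeval (fun i => π (C (p i))) f = 0 := by
    rw [← comp_aeval_apply, show aeval (fun i => C (p i)) f = C (eval p f) from
      aeval_algebraMap_apply _ p f, hf, map_zero, map_zero]
  have hmul : π f * π (C (p j)) ^ d = 0 := by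
    rw [← aeval_X_left_apply f, comp_aeval_apply, ← aeval_mul_of_isHomogeneous hd]
    simp only [hX]
    rw [aeval_mul_of_isHomogeneous hd, hval, zero_mul]
  rw [← Ideal.Quotient.eq_zero_iff_mem]
  exact (((isUnit_iff_ne_zero.2 hj).map C).map π |>.pow d).mul_left_eq_zero.1 hmul

theorem exists_formsVanishingAt_eq {L : Submodule K (σ → K)}
    (hL : Module.finrank K L + 1 = Fintype.card σ) : ∃ p ≠ 0, formsVanishingAt p = L := by
  classical
  have hlt : L < ⊤ := lt_top_iff_ne_top.2 fun h => by
    rw [h, finrank_top, Module.finrank_fintype_fun_eq_card] at hL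
    omega
  obtain ⟨φ, hφ, hle⟩ := Submodule.exists_le_ker_of_lt_top L hlt
  obtain ⟨p, rfl⟩ := (dotProductEquiv K σ).surjective φ
  have hker : formsVanishingAt p = LinearMap.ker (dotProductEquiv K σ p) := by
    ext v
    simp [formsVanishingAt, Fintype.linearCombination_apply, dotProduct, mul_comm]
  refine ⟨p, fun h => hφ (by rw [h, map_zero]), hker.trans ?_⟩
  refine (Submodule.eq_of_le_of_finrank_eq hle ?_).symm
  have := Module.Dual.finrank_ker_add_one_of_ne_zero hφ
  rw [Module.finrank_fintype_fun_eq_card] at this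
  omega

theorem formsVanishingAt_smul {a : K} (ha : a ≠ 0) (p : σ → K) :
    formsVanishingAt (a • p) = formsVanishingAt p := by
  ext v
  have : ∑ i, v i * (a * p i) = a * ∑ i, v i * p i := by
    rw [Finset.mul_sum]
    exact Finset.sum_congr rfl fun i _ => mul_left_comm _ _ _
  simp [formsVanishingAt, Fintype.linearCombination_apply, this, ha]

end Points

section Plane

variable {K : Type*} [Field K]

theorem pointIdeal_eq_flatIdeal (P : Plane K) :
    pointIdeal P = flatIdeal (formsVanishingAt P.rep) := by
  refine le_antisymm (Ideal.span_le.2 ?_) (Ideal.span_le.2 ?_)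
  · rintro f ⟨⟨d, hd⟩, hf⟩
    exact mem_flatIdeal_of_eval_eq_zero P.rep_nonzero hd hf
  · rintro _ ⟨v, hv, rfl⟩
    exact Ideal.subset_span ⟨⟨1, linForm_isHomogeneous v⟩, mem_formsVanishingAt.1 hv⟩

theorem exists_point_formsVanishingAt_eq {L : Submodule K (Fin 3 → K)}
    (hL : Module.finrank K L = 2) : ∃ P : Plane K, formsVanishingAt P.rep = L := by
  obtain ⟨p, hp, rfl⟩ := exists_formsVanishingAt_eq (L := L) (by rw [hL, Fintype.card_fin])
  obtain ⟨a, ha⟩ := Projectivization.exists_smul_eq_mk_rep K p hp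
  exact ⟨.mk K p hp, ha ▸ formsVanishingAt_smul a.ne_zero p⟩

theorem mem_fatPointsIdeal_iff {S : Set (Plane K)} {m : Plane K → ℕ} {f : CoordRing K} :
    f ∈ fatPointsIdeal S m ↔ ∀ P ∈ S, f ∈ flatIdeal (formsVanishingAt P.rep) ^ m P := by
  simp [fatPointsIdeal, pointIdeal_eq_flatIdeal]

variable {n : ℕ} (v : Fin n → Fin 3 → K)

theorem numLines_eq_weight (P : Plane K) : numLines (fun i => linForm (v i)) P =
    weight (Finset.univ.val.map v) (formsVanishingAt P.rep) := by
  classical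
  rw [weight, Multiset.countP_map, numLines, Set.ncard_eq_toFinset_card']
  simp only [mem_formsVanishingAt, Set.toFinset_ofPred]
  rfl

theorem mem_flatIdeal_pow_of_mem_symbolicPower {t : ℕ} {f : CoordRing K}
    (hf : f ∈ symbolicPower (fun i => linForm (v i)) t) {L : Submodule K (Fin 3 → K)}
    (hL : Module.finrank K L = 2) :
    f ∈ flatIdeal L ^ (t * (weight (Finset.univ.val.map v) L - 1)) := by
  obtain ⟨P, rfl⟩ := exists_point_formsVanishingAt_eq hL
  rw [← numLines_eq_weight]
  obtain hP | hP := le_or_gt 2 (numLines (fun i => linForm (v i)) P)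
  · exact mem_fatPointsIdeal_iff.1 hf P hP
  · simp [Nat.sub_eq_zero_of_le (Nat.le_of_lt_succ hP)]

theorem productIdeal_eq_foldIdeal (hn : n ≠ 0) :
    productIdeal (fun i => linForm (v i)) = foldIdeal (Finset.univ.val.map v) (n - 1) := by
  classical
  have hcons : ∀ i, Finset.univ.val.map v = v i ::ₘ (Finset.univ.erase i).val.map v := fun i => by
    rw [← Multiset.map_cons, Finset.erase_val, Multiset.cons_erase (Finset.mem_univ i)]
  have hrange : {t | t ≤ Finset.univ.val.map v ∧ t.card = n - 1} =
      Set.range fun i => (Finset.univ.erase i).val.map v := by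
    ext t
    constructor
    · rintro ⟨hle, hcard⟩
      obtain ⟨u, hu⟩ := Multiset.le_iff_exists_add.1 hle
      obtain ⟨w, rfl⟩ : ∃ w, u = {w} := Multiset.card_eq_one.1 (by
        have := congrArg Multiset.card hu
        simp only [Multiset.card_map, Finset.card_val, Finset.card_fin, Multiset.card_add] at this
        omega)
      obtain ⟨i, -, rfl⟩ := Multiset.mem_map.1 (hu ▸ Multiset.mem_add.2 (.inr (by simp)) :
        w ∈ Finset.univ.val.map v)
      refine ⟨i, Multiset.cons_inj_right (v i) |>.1 ?_⟩
      rw [← hcons i, hu, add_comm, Multiset.singleton_add]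
    · rintro ⟨i, rfl⟩
      exact ⟨hcons i ▸ Multiset.le_cons_self _ _, by simp⟩
  rw [foldIdeal, hrange, ← Set.range_comp, productIdeal]
  simp only [Function.comp_def, Multiset.map_map]
  rfl

theorem productIdeal_le_fatPointsIdeal (hn : n ≠ 0) :
    productIdeal (fun i => linForm (v i)) ≤
      fatPointsIdeal (singularLocus fun i => linForm (v i))
        (lineMult fun i => linForm (v i)) := by
  refine fun f hf => mem_fatPointsIdeal_iff.2 fun P _ => ?_
  rw [lineMult, numLines_eq_weight]
  rw [productIdeal_eq_foldIdeal v hn] at hf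
  refine Ideal.pow_le_pow_right ?_ (foldIdeal_le_flatIdeal_pow _ _ _ hf)
  simp
  omega

theorem irrelevantIdeal_eq_flatIdeal : irrelevantIdeal K = flatIdeal ⊤ :=
  flatIdeal_top.symm

theorem mem_flatIdeal_pow_of_vanishing {Λ : Finset (Fin 3 → K)}
    (hΛ : (Λ : Set (Fin 3 → K)).Pairwise fun u v => u ∉ K ∙ v) (hcard : 2 ≤ Λ.card) {t : ℕ}
    {f : CoordRing K} (hf : ∀ L : Submodule K (Fin 3 → K), Module.finrank K L = 2 →
      f ∈ flatIdeal L ^ (t * (weight Λ.val L - 1))) (L : Submodule K (Fin 3 → K)) :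
    f ∈ flatIdeal L ^ ((t + 1) / 2 * (weight Λ.val L - 1)) := by
  classical
  obtain hw | hw := le_or_gt (weight Λ.val L) 1
  · simp [Nat.sub_eq_zero_of_le hw]
  have hlines : 1 < (Λ.filter (· ∈ L)).card := by
    rwa [weight, Multiset.countP_eq_card_filter] at hw
  obtain ⟨u, hu, w, hw, hne⟩ := Finset.one_lt_card.1 hlines
  obtain ⟨huΛ, huL⟩ := Finset.mem_filter.1 hu
  obtain ⟨hwΛ, hwL⟩ := Finset.mem_filter.1 hw
  have hge : 2 ≤ Module.finrank K L := by
    rw [← finrank_span_sup_span (ne_zero_of_pairwise_notMem_span hΛ hcard hwΛ) (hΛ huΛ hwΛ hne)]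
    exact Submodule.finrank_mono (by simp [huL, hwL])
  obtain hL | hL := hge.eq_or_lt
  · exact Ideal.pow_le_pow_right (Nat.mul_le_mul_right _ (by omega)) (hf L hL.symm)
  · obtain rfl : L = ⊤ := Submodule.eq_top_of_finrank_eq
      ((Submodule.finrank_le L).antisymm (by rwa [Module.finrank_fin_fun]))
    rw [weight_eq_card fun _ _ => Submodule.mem_top]
    exact Ideal.pow_le_pow_right (Nat.le_add_right _ _)
      (mem_flatIdeal_top_pow_of_vanishing hΛ hcard hf)

theorem mem_pow_mul_foldIdeal_pow_of_vanishing {Λ : Finset (Fin 3 → K)}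
    (hΛ : (Λ : Set (Fin 3 → K)).Pairwise fun u v => u ∉ K ∙ v) (hcard : 2 ≤ Λ.card) {t : ℕ}
    {f : CoordRing K} (hf : ∀ L : Submodule K (Fin 3 → K), Module.finrank K L = 2 →
      f ∈ flatIdeal L ^ (t * (weight Λ.val L - 1))) :
    f ∈ flatIdeal ⊤ ^ (t / 2) * foldIdeal Λ.val (Λ.card - 1) ^ ((t + 1) / 2) := by
  set c := (t + 1) / 2
  have hexp : ∀ L : Submodule K (Fin 3 → K), weight (c • Λ.val) L + c * (Λ.card - 1) -
      (c • Λ.val).card = c * (weight Λ.val L - 1) := fun L => by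
    have := Nat.mul_le_mul_left c (one_le_two.trans hcard)
    rw [weight_nsmul, Multiset.card_nsmul, Finset.card_val, Nat.mul_sub, Nat.mul_sub]
    omega
  have h := mem_pow_mul_foldIdeal_sup (t / 2) ⊥ (c * (Λ.card - 1)) (c • Λ.val) f
    (fun L _ => Ideal.mem_sup_left (hexp L ▸ mem_flatIdeal_pow_of_vanishing hΛ hcard hf L))
    (Ideal.mem_sup_left (mem_flatIdeal_top_pow_of_vanishing hΛ hcard hf))
  rw [flatIdeal_bot, sup_bot_eq] at h
  have hne : Λ.val ≠ 0 := fun h0 => by simp [Finset.val_eq_zero.1 h0] at hcard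
  exact Ideal.mul_mono_right (foldIdeal_nsmul_le_pow hne c) h

variable {v}

theorem symbolicPower_le (hv : Pairwise fun i j => v i ∉ K ∙ v j) (hn : 2 ≤ n) (t : ℕ) :
    symbolicPower (fun i => linForm (v i)) t ≤
      irrelevantIdeal K ^ (t / 2) * productIdeal (fun i => linForm (v i)) ^ ((t + 1) / 2) := by
  have hinj : Function.Injective v := fun i j hij => by_contra fun hne =>
    hv hne (hij ▸ Submodule.mem_span_singleton_self _)
  set Λ : Finset (Fin 3 → K) := Finset.univ.map ⟨v, hinj⟩
  have hcard : Λ.card = n := by simp [Λ]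
  have hΛ : (Λ : Set (Fin 3 → K)).Pairwise fun u w => u ∉ K ∙ w := by
    simp only [Λ, Finset.coe_map, Finset.coe_univ, Set.image_univ]
    rintro _ ⟨i, rfl⟩ _ ⟨j, rfl⟩ hne
    exact hv (ne_of_apply_ne v hne)
  intro f hf
  rw [irrelevantIdeal_eq_flatIdeal, productIdeal_eq_foldIdeal v (by omega)]
  have hmem := mem_pow_mul_foldIdeal_pow_of_vanishing hΛ (hn.trans_eq hcard.symm) fun L =>
    mem_flatIdeal_pow_of_mem_symbolicPower v hf
  rwa [hcard] at hmem

end Plane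

theorem le_card_of_height_span_range_eq {R ι : Type*} [CommRing R] [IsNoetherianRing R]
    [Fintype ι] {a : ι → R} {k : ℕ} (hk : (Ideal.span (Set.range a)).height = k) :
    k ≤ Fintype.card ι := by
  have hne : Ideal.span (Set.range a) ≠ ⊤ := fun h => by
    rw [h, Ideal.height_top] at hk
    exact ENat.top_ne_natCast k hk
  have hle : (Ideal.span (Set.range a)).height ≤ Fintype.card ι :=
    calc _ ≤ ((Ideal.span (Set.range a)).spanFinrank : ℕ∞) := Ideal.height_le_spanFinrank _ hne
      _ ≤ (Set.range a).encard := Submodule.spanFinrank_span_le_encard _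
      _ ≤ (Set.univ : Set ι).encard := Set.image_univ ▸ Set.encard_image_le a _
      _ = Fintype.card ι := by rw [Set.encard_univ, ENat.card_eq_coe_fintype_card]
  exact_mod_cast hk ▸ hle

end LineArrangement

open LineArrangement in
theorem corollary3p4_general {K : Type*} [Field K] {n : ℕ} (ℓ : Fin n → CoordRing K)
    (hlin : ∀ i, (ℓ i).IsHomogeneous 1) (hdistinct : ∀ i j, i ≠ j → ∀ c : K, ℓ i ≠ c • ℓ j)
    (hn : 2 ≤ n) :
    productIdeal ℓ = fatPointsIdeal (singularLocus ℓ) (lineMult ℓ) ∧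
      ∀ t : ℕ, symbolicPower ℓ t ≤
        irrelevantIdeal K ^ (t / 2) * productIdeal ℓ ^ ((t + 1) / 2) := by
  choose v hv using fun i => exists_linForm_eq (hlin i)
  obtain rfl : (fun i => linForm (v i)) = ℓ := funext hv
  have hpair : Pairwise fun i j => v i ∉ K ∙ v j := fun i j hij hmem => by
    obtain ⟨c, hc⟩ := Submodule.mem_span_singleton.1 hmem
    exact hdistinct i j hij c (by simp only [← hc, map_smul])
  have hle := symbolicPower_le hpair hn
  refine ⟨(productIdeal_le_fatPointsIdeal v (by omega)).antisymm ?_, hle⟩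
  simpa [symbolicPower, fatPointsSymbolicPower] using hle 1

theorem corollary3p4 {K : Type*} [Field K] [CharZero K] {n : ℕ}
    (ℓ : Fin n → LineArrangement.CoordRing K)
    -- the `ℓ i` are nonzero linear forms defining pairwise distinct lines
    (hlin : ∀ i, (ℓ i).IsHomogeneous 1)
    (hne : ∀ i, ℓ i ≠ 0)
    (hdistinct : ∀ i j, i ≠ j → ∀ c : K, ℓ i ≠ c • ℓ j)
    -- the arrangement has rank three
    (hrank : (Ideal.span (Set.range ℓ)).height = 3) :
    LineArrangement.productIdeal ℓ =
        LineArrangement.fatPointsIdeal (LineArrangement.singularLocus ℓ)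
          (LineArrangement.lineMult ℓ) ∧
      ∀ r : ℕ, 1 ≤ r →
        LineArrangement.symbolicPower ℓ (2 * r - 1) ≤
            LineArrangement.irrelevantIdeal K ^ (r - 1) * LineArrangement.productIdeal ℓ ^ r ∧
          LineArrangement.symbolicPower ℓ (2 * r) ≤
            LineArrangement.irrelevantIdeal K ^ r * LineArrangement.productIdeal ℓ ^ r := by
  have hn : 3 ≤ n := by simpa using LineArrangement.le_card_of_height_span_range_eq (k := 3) hrank
  obtain ⟨hfat, hle⟩ := corollary3p4_general ℓ hlin hdistinct (by omega)
  refine ⟨hfat, fun r hr => ⟨?_, ?_⟩⟩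
  · convert hle (2 * r - 1) using 3 <;> omega
  · convert hle (2 * r) using 3 <;> omega
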